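/- Corollary 5.11. A ceer is an equivalence relation $R$ on $\mathbb N$ that is computably enumerable as a set of pairs. For ceers $R,S$ write $R\le S$ if there is a computable function $f:\mathbb N\to\mathbb N$ such that $x\,R\,y\Leftrightarrow f(x)\,S\,f(y)$ for all $x,y\in\mathbb N$. A ceer is FC if all of its equivalence classes are finite, and CC if all of its equivalence classes are computable. A ceer $R$ is universal for a class $\mathcal C$ of ceers if $R\in\mathcal C$ and $S\le R$ for every $S\in\mathcal C$, and $R$ is essentially in $\mathcal C$ if $R\le S$ for some $S\in\mathcal C$. Let $W_e$ be the domain of the $e$-th partial computable function in a standard (acceptable) numbering, let $\langle\cdot,\cdot\rangle$ be a computable bijection $\mathbb N^2\to\mathbb N$, and let $R_e$ be the equivalence relation on $\mathbb N$ generated by $\{(x,y) : \langle x,y\rangle\in W_e\}$. Then: 1. There is no universal FC ceer, i.e. no ceer is universal for the class of FC ceers. 2. There is no universal CC ceer, i.e. no ceer is universal for the class of CC ceers. 3. There is a CC ceer that is not essentially FC. 4. The index set $\{e : R_e\text{ is FC}\}$ is $\Pi_3$-complete (it is $\Pi_3$ in the arithmetical hierarchy and every $\Pi_3$ subset of $\mathbb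 N$ is many-one reducible to it). 5. The index set $\{e : R_e\text{ is CC}\}$ is $\Pi_4$-complete (in the same sense, with $\Pi_4$ in place of $\Pi_3$). -/

import Mathlib

namespace CeerTheory

/-- An equivalence relation on the natural numbers is a ceer if it is computably enumerable
as a set of pairs. -/
def IsCeer (R : Setoid ℕ) : Prop :=
  REPred fun p : ℕ × ℕ => R p.1 p.2

/-- `R` is (many-one) reducible to `S`: some computable `f` satisfies `x R y ↔ f x S f y`. -/
def Reducible (R S : Setoid ℕ) : Prop :=
  ∃ f : ℕ → ℕ, Computable f ∧ ∀ x y, R x y ↔ S (f x) (f y)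

/-- A ceer all of whose equivalence classes are finite. -/
def IsFC (R : Setoid ℕ) : Prop :=
  IsCeer R ∧ ∀ x, {y | R x y}.Finite

/-- A ceer all of whose equivalence classes are computable. -/
def IsCC (R : Setoid ℕ) : Prop :=
  IsCeer R ∧ ∀ x, ComputablePred fun y => R x y

/-- `R` is universal for the class `C`: it belongs to `C` and every member of `C` reduces
to it. -/
def IsUniversalFor (C : Setoid ℕ → Prop) (R : Setoid ℕ) : Prop :=
  C R ∧ ∀ S, C S → Reducible S R

/-- `R` is essentially in the class `C`: it reduces to some member of `C`. -/
def IsEssentially (C : Setoid ℕ → Prop) (R : Setoid ℕ) : Prop :=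
  ∃ S, C S ∧ Reducible R S

/-- The `e`-th c.e. set: the domain of the `e`-th partial computable function. -/
def W (e : ℕ) : Set ℕ :=
  {x | ((Denumerable.ofNat Nat.Partrec.Code e).eval x).Dom}

/-- The ceer with canonical index `e`: the equivalence relation generated by the pairs
coded in `W e`. -/
def ceerOfIndex (e : ℕ) : Setoid ℕ :=
  Relation.EqvGen.setoid fun x y => Nat.pair x y ∈ W e

/-- The `Σ_n` sets of the arithmetical hierarchy. A set is `Σ_0` if it is computable, and
`Σ_(n+1)` if it has the form `{x | ∃ y, ⟨x, y⟩ ∈ B}` where `B` is `Π_n`, that is, the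
complement of `B` is `Σ_n`. -/
def IsSigma : ℕ → Set ℕ → Prop
  | 0, A => ComputablePred fun x => x ∈ A
  | n + 1, A => ∃ B : Set ℕ, IsSigma n Bᶜ ∧ ∀ x, x ∈ A ↔ ∃ y, Nat.pair x y ∈ B

/-- The `Π_n` sets: the complements of `Σ_n` sets. -/
def IsPi (n : ℕ) (A : Set ℕ) : Prop :=
  IsSigma n Aᶜ

/-- `A` is `Π_n`-complete: it is `Π_n`, and every `Π_n` set is many-one reducible to it. -/
def IsPiComplete (n : ℕ) (A : Set ℕ) : Prop :=
  IsPi n A ∧ ∀ B : Set ℕ, IsPi n B → ManyOneReducible (fun x => x ∈ B) (fun x => x ∈ A)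

end CeerTheory

/-! Every ceer constructed here has one form: `ℕ` is split into columns and an r.e. set `D n` is
collapsed inside column `n`. Such a ceer is FC iff every `D n` is finite, and CC iff every `D n` is
computable (`isFC_columnSetoid`, `isCC_columnSetoid`).

For non-universality, fix a CC ceer `R` and an enumeration `k` of a noncomputable set. Column `e`
collapses `k 0, k 1, ...` one at a time, each only after the `e`-th function appears to reduce the
current column to `R`. If this never stopped, the range of `k` would be the preimage of an
`R`-class, hence computable. So every column stops at a finite set, exactly where the reduction
fails. As FC ceers are CC, this settles both classes.

For the CC ceer that is not essentially FC, each column collapses an initial segment, which is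
computable whether or not it is finite. It grows while a candidate reduction keeps sending a fresh
image into one class. A finite class stops this, and the reduction then fails.

The upper bounds count quantifiers. For hardness, a Σ₂ condition is coded as finiteness of an
initial segment, and a Σ₃ condition as computability of a r.e. set
(`computablePred_thickHalting_iff`); columns supply the outer universal quantifier. -/

open Nat.Partrec (Code)
open Encodable Denumerable

-- Closure properties of computable and r.e. predicates.

attribute [fun_prop] Computable
attribute [fun_prop] Computable.id Computable.const

namespace Computable

variable {α β γ : Type*} [Primcodable α] [Primcodable β] [Primcodable γ]

@[fun_prop]
theorem comp_fun {g : β → γ} {f : α → β} (hg : Computable g) (hf : Computable f) :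
    Computable fun a => g (f a) := hg.comp hf

@[fun_prop]
theorem prodMk {f : α → β} {g : α → γ} (hf : Computable f) (hg : Computable g) :
    Computable fun a => (f a, g a) := hf.pair hg

@[fun_prop]
theorem fst_comp {f : α → β × γ} (hf : Computable f) : Computable fun a => (f a).1 :=
  Computable.fst.comp hf

@[fun_prop]
theorem snd_comp {f : α → β × γ} (hf : Computable f) : Computable fun a => (f a).2 :=
  Computable.snd.comp hf

@[fun_prop]
theorem natPair {f g : α → ℕ} (hf : Computable f) (hg : Computable g) :
    Computable fun a => Nat.pair (f a) (g a) :=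
  Primrec₂.natPair.to_comp.comp hf hg

@[fun_prop]
theorem natUnpair {f : α → ℕ} (hf : Computable f) : Computable fun a => Nat.unpair (f a) :=
  Computable.unpair.comp hf

@[fun_prop]
theorem natAdd {f g : α → ℕ} (hf : Computable f) (hg : Computable g) :
    Computable fun a => f a + g a :=
  Primrec.nat_add.to_comp.comp hf hg

@[fun_prop]
theorem ofNat_comp {δ : Type*} [Denumerable δ] {f : α → ℕ} (hf : Computable f) :
    Computable fun a => Denumerable.ofNat δ (f a) :=
  (Computable.ofNat δ).comp hf

@[fun_prop]
theorem encode_comp {f : α → β} (hf : Computable f) : Computable fun a => encode (f a) :=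
  Computable.encode.comp hf

@[fun_prop]
theorem listGetD {f : α → List ℕ} {g : α → ℕ} (hf : Computable f) (hg : Computable g) :
    Computable fun a => (f a).getD (g a) 0 :=
  (Primrec.list_getD 0).to_comp.comp hf hg

end Computable

theorem ComputablePred.comp {α β : Type*} [Primcodable α] [Primcodable β] {p : β → Prop}
    {f : α → β} (hp : ComputablePred p) (hf : Computable f) : ComputablePred fun a => p (f a) := by
  obtain ⟨_, hp⟩ := hp
  exact ⟨inferInstance, hp.comp hf⟩

theorem ComputablePred.natEq {α : Type*} [Primcodable α] {f g : α → ℕ} (hf : Computable f)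
    (hg : Computable g) : ComputablePred fun a => f a = g a :=
  (Primrec.eq (α := ℕ)).computablePred.comp (hf.pair hg)

theorem ComputablePred.natLt {α : Type*} [Primcodable α] {f g : α → ℕ} (hf : Computable f)
    (hg : Computable g) : ComputablePred fun a => f a < g a :=
  Primrec.nat_lt.computablePred.comp (hf.pair hg)

theorem ComputablePred.natLe {α : Type*} [Primcodable α] {f g : α → ℕ} (hf : Computable f)
    (hg : Computable g) : ComputablePred fun a => f a ≤ g a :=
  Primrec.nat_le.computablePred.comp (hf.pair hg)

/-- `HaltsIn c n s`: the computation of `c` on input `n` halts within `s` steps. -/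
def HaltsIn (c : Code) (n s : ℕ) : Prop := (c.evaln s n).isSome

theorem HaltsIn.mono {c : Code} {n s t : ℕ} (hst : s ≤ t) (h : HaltsIn c n s) : HaltsIn c n t := by
  obtain ⟨v, hv⟩ := Option.isSome_iff_exists.1 h
  exact Option.isSome_iff_exists.2 ⟨v, Code.evaln_mono hst hv⟩

theorem dom_iff_exists_haltsIn {c : Code} {n : ℕ} : (c.eval n).Dom ↔ ∃ s, HaltsIn c n s := by
  simp only [Part.dom_iff_mem, Code.evaln_complete, HaltsIn, Option.isSome_iff_exists,
    Option.mem_def]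
  exact exists_comm

theorem primrecPred_haltsIn :
    PrimrecPred fun p : (Code × ℕ) × ℕ => HaltsIn p.1.1 p.1.2 p.2 := by
  refine ⟨fun p => inferInstanceAs (Decidable ((p.1.1.evaln p.2 p.1.2).isSome = true)), ?_⟩
  have h : Primrec fun p : (Code × ℕ) × ℕ => (p.1.1.evaln p.2 p.1.2).isSome :=
    Primrec.option_isSome.comp (Code.primrec_evaln.comp
      ((Primrec.snd.pair (Primrec.fst.comp .fst)).pair (Primrec.snd.comp .fst)))
  exact h.of_eq fun p => Bool.decide_eq_true.symm

theorem computablePred_haltsIn {α : Type*} [Primcodable α] {f : α → Code} {g h : α → ℕ}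
    (hf : Computable f) (hg : Computable g) (hh : Computable h) :
    ComputablePred fun a => HaltsIn (f a) (g a) (h a) :=
  primrecPred_haltsIn.computablePred.comp ((hf.pair hg).pair hh)

namespace REPred

variable {α β : Type*} [Primcodable α] [Primcodable β]

theorem comp {p : β → Prop} {f : α → β} (hp : REPred p) (hf : Computable f) :
    REPred fun a => p (f a) :=
  Partrec.comp hp hf

theorem exists_code {p : α → Prop} (hp : REPred p) :
    ∃ c : Code, ∀ a, p a ↔ (c.eval (encode a)).Dom := by
  obtain ⟨c, hc⟩ := Code.exists_code.1 hp
  refine ⟨c, fun a => ?_⟩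
  simp [hc, Part.assert]

/-- A recursively enumerable predicate is the increasing union of a computable sequence of
predicates. -/
theorem exists_stages {p : α → Prop} (hp : REPred p) :
    ∃ q : α → ℕ → Prop, PrimrecRel q ∧ (∀ a s t, s ≤ t → q a s → q a t) ∧
      ∀ a, p a ↔ ∃ s, q a s := by
  obtain ⟨c, hc⟩ := hp.exists_code
  refine ⟨fun a s => HaltsIn c (encode a) s, ?_, fun a s t h => HaltsIn.mono h, fun a => ?_⟩
  · exact primrecPred_haltsIn.comp
      (((Primrec.const c).pair (Primrec.encode.comp .fst)).pair .snd)
  · rw [hc, dom_iff_exists_haltsIn]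

theorem exists_nat_of_computable {q : α → ℕ → Prop}
    (hq : ComputablePred fun p : α × ℕ => q p.1 p.2) : REPred fun a => ∃ s, q a s := by
  classical
  have h : Partrec fun a => Nat.rfind fun n => Part.some (decide (q a n)) :=
    Partrec.rfind hq.decide.partrec
  refine h.dom_re.of_eq fun a => ?_
  exact Nat.rfind_dom.trans (by simp)

theorem exists_nat {q : α → ℕ → Prop} (hq : REPred fun p : α × ℕ => q p.1 p.2) :
    REPred fun a => ∃ n, q a n := by
  obtain ⟨r, hr, -, hqr⟩ := hq.exists_stages
  have : REPred fun a => ∃ m : ℕ, r (a, m.unpair.1) m.unpair.2 := by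
    refine exists_nat_of_computable (q := fun a m => r (a, m.unpair.1) m.unpair.2) ?_
    exact hr.computablePred.comp
      (f := fun p : α × ℕ => ((p.1, p.2.unpair.1), p.2.unpair.2)) (by fun_prop)
  refine this.of_eq fun a => ⟨fun ⟨m, hm⟩ => ⟨_, (hqr (a, _)).2 ⟨_, hm⟩⟩, fun ⟨n, hn⟩ => ?_⟩
  obtain ⟨s, hs⟩ := (hqr (a, n)).1 hn
  exact ⟨Nat.pair n s, by simpa using hs⟩

theorem exists_denumerable {δ : Type*} [Denumerable δ] {q : α → δ → Prop}
    (hq : REPred fun p : α × δ => q p.1 p.2) : REPred fun a => ∃ n, q a n := by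
  have : REPred fun a => ∃ n : ℕ, q a (ofNat δ n) :=
    exists_nat (q := fun a n => q a (ofNat δ n))
      (hq.comp (f := fun p : α × ℕ => (p.1, ofNat δ p.2)) (by fun_prop))
  refine this.of_eq fun a => ⟨fun ⟨n, h⟩ => ⟨_, h⟩, fun ⟨d, h⟩ => ⟨encode d, by simpa using h⟩⟩

protected theorem and {p q : α → Prop} (hp : REPred p) (hq : REPred q) :
    REPred fun a => p a ∧ q a := by
  refine (Partrec.bind hp (g := fun a _ => Part.assert (q a) fun _ => Part.some ())
    (Partrec.comp hq Computable.fst)).dom_re.of_eq fun a => ?_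
  simp [Part.bind_dom, Part.assert]

protected theorem or {p q : α → Prop} (hp : REPred p) (hq : REPred q) :
    REPred fun a => p a ∨ q a := by
  obtain ⟨r, hr, -, hpr⟩ := hp.exists_stages
  obtain ⟨r', hr', -, hqr⟩ := hq.exists_stages
  refine (exists_nat_of_computable (q := fun a s => r a s ∨ r' a s)
    (PrimrecPred.or hr hr').computablePred).of_eq fun a => ?_
  rw [hpr, hqr, exists_or]

theorem forall_lt {q : α → ℕ → Prop} {b : α → ℕ} (hb : Computable b)
    (hq : REPred fun p : α × ℕ => q p.1 p.2) : REPred fun a => ∀ m < b a, q a m := by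
  obtain ⟨r, hr, hmono, hqr⟩ := hq.exists_stages
  have hR : PrimrecRel fun (m : ℕ) (p : α × ℕ) => r (p.1, m) p.2 :=
    hr.comp ((Primrec.fst.comp .snd).pair .fst) (Primrec.snd.comp .snd)
  have : ComputablePred fun p : α × ℕ => ∀ m < b p.1, r (p.1, m) p.2 :=
    (ComputablePred.comp hR.forall_mem_list.computablePred
      ((Primrec.list_range.to_comp.comp (hb.comp .fst)).pair .id)).of_eq (by simp)
  refine (exists_nat_of_computable (q := fun a s => ∀ m < b a, r (a, m) s) this).of_eq
    fun a => ⟨fun ⟨s, h⟩ m hm => (hqr (a, m)).2 ⟨s, h m hm⟩, fun h => ?_⟩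
  choose s hs using fun m (hm : m < b a) => (hqr (a, m)).1 (h m hm)
  -- The sum is a common upper bound for the finitely many witnessing stages.
  refine ⟨∑ m ∈ (Finset.range (b a)).attach, s m.1 (Finset.mem_range.1 m.2), fun m hm => ?_⟩
  refine hmono _ _ _ ?_ (hs m hm)
  exact Finset.single_le_sum (f := fun m : Finset.range (b a) => s m.1 (Finset.mem_range.1 m.2))
    (fun _ _ => Nat.zero_le _) (Finset.mem_attach _ ⟨m, Finset.mem_range.2 hm⟩)

theorem eval_dom {f : α → Code} {g : α → ℕ} (hf : Computable f) (hg : Computable g) :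
    REPred fun a => ((f a).eval (g a)).Dom :=
  (Code.eval_part.comp hf hg).dom_re

theorem mem_eval {f : α → Code} {g h : α → ℕ} (hf : Computable f) (hg : Computable g)
    (hh : Computable h) : REPred fun a => h a ∈ (f a).eval (g a) := by
  have hp : REPred fun p : (Code × ℕ) × ℕ => p.2 ∈ p.1.1.eval p.1.2 := by
    have h1 : PrimrecPred fun q : ((Code × ℕ) × ℕ) × ℕ =>
        Code.evaln q.2 q.1.1.1 q.1.1.2 = some q.1.2 := by
      refine Primrec.eq.comp (Primrec.comp Code.primrec_evaln
        (g := fun q : ((Code × ℕ) × ℕ) × ℕ => ((q.2, q.1.1.1), q.1.1.2)) ?_) ?_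
      · exact (Primrec.snd.pair (Primrec.fst.comp (Primrec.fst.comp .fst))).pair
          (Primrec.snd.comp (Primrec.fst.comp .fst))
      · exact Primrec.option_some.comp (Primrec.snd.comp .fst)
    exact (exists_nat_of_computable (q := fun p s => Code.evaln s p.1.1 p.1.2 = some p.2)
      h1.computablePred).of_eq fun p => Code.evaln_complete.symm
  exact hp.comp ((hf.pair hg).pair hh)

end REPred

namespace ComputablePred

variable {α : Type*} [Primcodable α] {p q : α → Prop}

protected theorem and (hp : ComputablePred p) (hq : ComputablePred q) :
    ComputablePred fun a => p a ∧ q a := by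
  obtain ⟨_, hp⟩ := hp
  obtain ⟨_, hq⟩ := hq
  exact ⟨inferInstance, (Primrec.and.to_comp.comp hp hq).of_eq fun a => by simp⟩

protected theorem or (hp : ComputablePred p) (hq : ComputablePred q) :
    ComputablePred fun a => p a ∨ q a := by
  obtain ⟨_, hp⟩ := hp
  obtain ⟨_, hq⟩ := hq
  exact ⟨inferInstance, (Primrec.or.to_comp.comp hp hq).of_eq fun a => by simp⟩

end ComputablePred

theorem HaltsIn.exists_uniform {c : Code} {x : ℕ → ℕ} {n : ℕ}
    (h : ∀ m < n, (c.eval (x m)).Dom) (t : ℕ) : ∃ s, t ≤ s ∧ ∀ m < n, HaltsIn c (x m) s := by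
  induction n with
  | zero => exact ⟨t, le_rfl, by simp⟩
  | succ n ih =>
    obtain ⟨s, hts, hs⟩ := ih fun m hm => h m (by omega)
    obtain ⟨s', hs'⟩ := dom_iff_exists_haltsIn.1 (h n (by omega))
    refine ⟨max s s', le_max_of_le_left hts, fun m hm => ?_⟩
    rcases Nat.lt_succ_iff_lt_or_eq.1 hm with hm | rfl
    · exact (hs m hm).mono (le_max_left _ _)
    · exact hs'.mono (le_max_right _ _)

theorem not_computablePred_halts :
    ¬ ComputablePred fun x : ℕ => ((ofNat Code x).eval 0).Dom := fun h =>
  ComputablePred.halting_problem 0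
    ((h.comp (f := fun c : Code => encode c) (by fun_prop)).of_eq fun c => by simp)

/-- The halting set works: `n` codes a program and a stage, and a fixed halting program `x₀` is
output when the stage is too small. -/
theorem exists_computable_range_not_computablePred :
    ∃ f : ℕ → ℕ, Computable f ∧ ¬ ComputablePred fun x => ∃ n, f n = x := by
  classical
  obtain ⟨x₀, hx₀⟩ : ∃ x : ℕ, ((ofNat Code x).eval 0).Dom :=
    ⟨encode Code.zero, by rw [ofNat_encode]; exact trivial⟩
  refine ⟨fun n => if HaltsIn (ofNat Code n.unpair.1) 0 n.unpair.2 then n.unpair.1 else x₀,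
    ComputablePred.ite (by fun_prop) (by fun_prop)
      (computablePred_haltsIn (by fun_prop) (by fun_prop) (by fun_prop)), fun h =>
      not_computablePred_halts ?_⟩
  refine h.of_eq fun x => ⟨?_, fun hx => ?_⟩
  · rintro ⟨n, rfl⟩
    dsimp only
    split_ifs with hn
    · exact dom_iff_exists_haltsIn.2 ⟨_, hn⟩
    · exact hx₀
  · obtain ⟨s, hs⟩ := dom_iff_exists_haltsIn.1 hx
    exact ⟨Nat.pair x s, by simp [hs]⟩

theorem Computable.exists_index {f : ℕ → ℕ} (hf : Computable f) :
    ∃ e : ℕ, ∀ x y, y ∈ (ofNat Code e).eval x ↔ y = f x := by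
  obtain ⟨c, hc⟩ := Code.exists_code.1 (Partrec.nat_iff.1 hf.partrec)
  exact ⟨encode c, fun x y => by simp [hc]⟩

theorem Set.Finite.computablePred {s : Set ℕ} (hs : s.Finite) :
    ComputablePred fun x => x ∈ s := by
  induction s, hs using Set.Finite.induction_on with
  | empty => exact ⟨fun x => isFalse (by simp), (Computable.const false).of_eq (by simp)⟩
  | @insert a s _ _ ih =>
    exact (ComputablePred.or (.natEq .id (.const a)) ih).of_eq fun x => by simp

/-- Nonuniform: an initial segment of `ℕ` is either everything or finite, and no decision between
the two is needed. -/
theorem computablePred_forall_lt (A : ℕ → Prop) : ComputablePred fun k => ∀ j < k, A j := by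
  by_cases h : ∀ j, A j
  · exact ⟨fun k => isTrue fun j _ => h j, (Computable.const true).of_eq fun k => by simp [h]⟩
  · push Not at h
    obtain ⟨j, hj⟩ := h
    exact ((Set.finite_Iic j).subset (t := {k | ∀ j < k, A j}) fun k hk =>
      not_lt.1 fun hjk => hj (hk j hjk)).computablePred

theorem finite_setOf_forall_lt {A : ℕ → Prop} : {k | ∀ j < k, A j}.Finite ↔ ∃ j, ¬ A j := by
  refine ⟨fun h => ?_, fun ⟨j, hj⟩ => (Set.finite_Iic j).subset fun k hk =>
    not_lt.1 fun hjk => hj (hk j hjk)⟩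
  by_contra! hA
  exact Set.infinite_univ (h.subset fun k _ j _ => hA j)

/-! ### Ceers that collapse one set per column. -/

namespace CeerTheory

theorem IsCeer.exists_code {R : Setoid ℕ} (hR : IsCeer R) :
    ∃ c : Code, ∀ x y, R x y ↔ (c.eval (Nat.pair x y)).Dom := by
  obtain ⟨c, hc⟩ := REPred.exists_code hR
  exact ⟨c, fun x y => by simpa using hc (x, y)⟩

theorem IsFC.isCC {R : Setoid ℕ} (hR : IsFC R) : IsCC R :=
  ⟨hR.1, fun x => (hR.2 x).computablePred⟩

/-- The equivalence relation on `ℕ`, viewed as the disjoint union of the columns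
`{Nat.pair n k | k}`, that collapses the elements `k` with `D n k` in each column `n`. -/
def columnSetoid (D : ℕ → ℕ → Prop) : Setoid ℕ where
  r x y := x = y ∨ x.unpair.1 = y.unpair.1 ∧ D x.unpair.1 x.unpair.2 ∧ D y.unpair.1 y.unpair.2
  iseqv :=
    { refl := fun _ => .inl rfl
      symm := fun h => h.imp Eq.symm fun ⟨h₁, h₂, h₃⟩ => ⟨h₁.symm, h₃, h₂⟩
      trans := by
        rintro x y z (rfl | ⟨h₁, h₂, h₃⟩) (rfl | ⟨h₄, h₅, h₆⟩)
        · exact .inl rfl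
        · exact .inr ⟨h₄, h₅, h₆⟩
        · exact .inr ⟨h₁, h₂, h₃⟩
        · exact .inr ⟨h₁.trans h₄, h₂, h₆⟩ }

section columnSetoid

variable {D : ℕ → ℕ → Prop}

theorem columnSetoid_iff {x y : ℕ} : columnSetoid D x y ↔ x = y ∨
    x.unpair.1 = y.unpair.1 ∧ D x.unpair.1 x.unpair.2 ∧ D y.unpair.1 y.unpair.2 := Iff.rfl

theorem columnSetoid_pair {n u v : ℕ} :
    columnSetoid D (Nat.pair n u) (Nat.pair n v) ↔ u = v ∨ D n u ∧ D n v := by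
  simp [columnSetoid_iff]

/-- The parameter in `α` gives the uniformity needed to compute indices in the hardness proofs. -/
theorem rePred_columnSetoid {α : Type*} [Primcodable α] {D : α → ℕ → ℕ → Prop}
    (hD : REPred fun p : α × ℕ × ℕ => D p.1 p.2.1 p.2.2) :
    REPred fun p : α × ℕ × ℕ => columnSetoid (D p.1) p.2.1 p.2.2 := by
  have h₁ : REPred fun p : α × ℕ × ℕ => p.2.1 = p.2.2 :=
    (ComputablePred.natEq (by fun_prop) (by fun_prop)).to_re
  have h₂ : REPred fun p : α × ℕ × ℕ => p.2.1.unpair.1 = p.2.2.unpair.1 :=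
    (ComputablePred.natEq (by fun_prop) (by fun_prop)).to_re
  exact h₁.or (h₂.and
    ((hD.comp (f := fun p : α × ℕ × ℕ => (p.1, p.2.1.unpair.1, p.2.1.unpair.2)) (by fun_prop)).and
      (hD.comp (f := fun p : α × ℕ × ℕ => (p.1, p.2.2.unpair.1, p.2.2.unpair.2)) (by fun_prop))))

theorem isCeer_columnSetoid (hD : REPred fun p : ℕ × ℕ => D p.1 p.2) :
    IsCeer (columnSetoid D) :=
  (rePred_columnSetoid (α := ℕ) (D := fun _ => D)
    (hD.comp (f := fun p : ℕ × ℕ × ℕ => p.2) (by fun_prop))).comp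
    (f := fun p : ℕ × ℕ => (0, p)) (by fun_prop)

theorem isFC_columnSetoid (hD : IsCeer (columnSetoid D)) :
    IsFC (columnSetoid D) ↔ ∀ n, {k | D n k}.Finite := by
  refine ⟨fun h n => ?_, fun h => ⟨hD, fun x => ?_⟩⟩
  · rcases Set.eq_empty_or_nonempty {k | D n k} with he | ⟨k, hk⟩
    · rw [he]; exact Set.finite_empty
    · refine ((h.2 (Nat.pair n k)).preimage (f := Nat.pair n) fun a _ b _ hab =>
        (Nat.pair_eq_pair.1 hab).2).subset fun m hm => columnSetoid_pair.2 (.inr ⟨hk, hm⟩)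
  · refine (((h x.unpair.1).image (Nat.pair x.unpair.1)).insert x).subset ?_
    rintro y (rfl | ⟨h₁, -, h₂⟩)
    · exact .inl rfl
    · refine .inr ⟨y.unpair.2, ?_, ?_⟩
      · show D x.unpair.1 y.unpair.2; rwa [h₁]
      · rw [h₁, Nat.pair_unpair]

theorem isCC_columnSetoid (hD : IsCeer (columnSetoid D)) :
    IsCC (columnSetoid D) ↔ ∀ n, ComputablePred (D n) := by
  refine ⟨fun h n => ?_, fun h => ⟨hD, fun x => ?_⟩⟩
  · by_cases he : ∃ k, D n k
    · obtain ⟨k, hk⟩ := he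
      refine ((h.2 (Nat.pair n k)).comp (f := Nat.pair n) (by fun_prop)).of_eq fun m => ?_
      rw [columnSetoid_pair]
      exact ⟨fun h => h.elim (fun h => h ▸ hk) And.right, fun h => .inr ⟨hk, h⟩⟩
    · push Not at he
      exact Set.finite_empty.computablePred.of_eq fun k => by simp [he]
  · by_cases hx : D x.unpair.1 x.unpair.2
    · have h₁ : ComputablePred fun y : ℕ => x.unpair.1 = y.unpair.1 :=
        .natEq (by fun_prop) (by fun_prop)
      have h₂ : ComputablePred fun y : ℕ => D x.unpair.1 y.unpair.2 :=
        (h _).comp (by fun_prop)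
      have h₃ : ComputablePred fun y : ℕ => x.unpair.1 = y.unpair.1 ∧ D x.unpair.1 y.unpair.2 :=
        h₁.and h₂
      refine h₃.of_eq fun y => ⟨fun ⟨hy, hy'⟩ => .inr ⟨hy, hx, hy ▸ hy'⟩, ?_⟩
      rintro (rfl | ⟨hy, -, hy'⟩)
      · exact ⟨rfl, hx⟩
      · exact ⟨hy, hy ▸ hy'⟩
    · refine (ComputablePred.natEq (α := ℕ) (.const x) .id).of_eq fun y =>
        ⟨fun h => .inl h, fun h => h.elim id fun h => (hx h.2.1).elim⟩

end columnSetoid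

/-! ### Diagonalizing against a CC ceer with an FC ceer. -/

section avoidCC

/-- `AvoidStep c k e t`: at some stage `s ≥ t`, the ceer with code `c` identifies the images
under the `e`-th function of the elements `k 0, …, k t` of column `e`, and of no
further elements `j ≤ t`. -/
def AvoidStep (c : Code) (k : ℕ → ℕ) (e t : ℕ) : Prop :=
  ∃ s, t ≤ s ∧ ∃ v, v ∈ (ofNat Code e).eval (Nat.pair e (k 0)) ∧ ∀ j < t + 1,
    (∃ w, w ∈ (ofNat Code e).eval (Nat.pair e (k j)) ∧ HaltsIn c (Nat.pair v w) s) ∧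
    ∃ u, u ∈ (ofNat Code e).eval (Nat.pair e j) ∧
      (¬ HaltsIn c (Nat.pair v u) s ∨ ∃ i, i < t + 1 ∧ k i = j)

theorem rePred_avoidStep {c : Code} {k : ℕ → ℕ} (hk : Computable k) :
    REPred fun p : ℕ × ℕ => AvoidStep c k p.1 p.2 := by
  unfold AvoidStep
  refine REPred.exists_nat (.and (ComputablePred.natLe (by fun_prop) (by fun_prop)).to_re
    (.exists_nat (.and (.mem_eval (by fun_prop) (by fun_prop) (by fun_prop))
      (.forall_lt (b := fun p : ((ℕ × ℕ) × ℕ) × ℕ => p.1.1.2 + 1) (by fun_prop) (.and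
        (.exists_nat (.and (.mem_eval (by fun_prop) (by fun_prop) (by fun_prop))
          (computablePred_haltsIn (by fun_prop) (by fun_prop) (by fun_prop)).to_re))
        (.exists_nat (.and (.mem_eval (by fun_prop) (by fun_prop) (by fun_prop))
          (.or (computablePred_haltsIn (by fun_prop) (by fun_prop) (by fun_prop)).not.to_re
            (.exists_nat (.and (ComputablePred.natLt (by fun_prop) (by fun_prop)).to_re
              (ComputablePred.natEq (by fun_prop) (by fun_prop)).to_re))))))))))

theorem exists_isFC_not_reducible {R : Setoid ℕ} (hR : IsCC R) :
    ∃ S, IsFC S ∧ ¬ Reducible S R := by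
  obtain ⟨c, hc⟩ := hR.1.exists_code
  obtain ⟨k, hk, hrange⟩ := exists_computable_range_not_computablePred
  -- If all steps succeeded, the range of `k` would be the preimage under `g` of the computable
  -- class of `g (k 0)`.
  have hfail : ∀ e, ∃ t, ¬ AvoidStep c k e t := by
    intro e
    by_contra! h
    have htot : ∀ j, ∃ u, u ∈ (ofNat Code e).eval (Nat.pair e j) := fun j => by
      obtain ⟨s, -, v, -, hj⟩ := h j
      obtain ⟨-, u, hu, -⟩ := hj j (by omega)
      exact ⟨u, hu⟩
    choose g hg using htot
    have hgc : Computable g :=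
      (Code.eval_part.comp (.const (ofNat Code e)) (by fun_prop)).of_eq_tot hg
    refine hrange (((hR.2 (g (k 0))).comp hgc).of_eq fun j => ⟨fun hj => ?_, ?_⟩)
    · rw [hc] at hj
      obtain ⟨s₀, hs₀⟩ := dom_iff_exists_haltsIn.1 hj
      -- A step late enough to examine `j` and to see that its image has already joined the class;
      -- `j` must then be some `k i`.
      obtain ⟨s, hs, v, hv, H⟩ := h (max s₀ j)
      obtain ⟨-, u, hu, H⟩ := H j (Nat.lt_succ_of_le (le_max_right _ _))
      rw [Part.mem_unique hv (hg _), Part.mem_unique hu (hg _)] at H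
      rcases H with H | ⟨i, -, hi⟩
      · exact (H (hs₀.mono ((le_max_left _ _).trans hs))).elim
      · exact ⟨i, hi⟩
    · rintro ⟨i, rfl⟩
      obtain ⟨s, -, v, hv, H⟩ := h i
      obtain ⟨⟨w, hw, H⟩, -⟩ := H i (by omega)
      rw [Part.mem_unique hv (hg _), Part.mem_unique hw (hg _)] at H
      exact (hc _ _).2 (dom_iff_exists_haltsIn.2 ⟨s, H⟩)
  let D : ℕ → ℕ → Prop := fun e x => ∃ t, k t = x ∧ ∀ j < t, AvoidStep c k e j
  have hD : REPred fun p : ℕ × ℕ => D p.1 p.2 := by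
    refine REPred.exists_nat (.and (ComputablePred.natEq (by fun_prop) (by fun_prop)).to_re
      (.forall_lt (b := fun p : (ℕ × ℕ) × ℕ => p.2) (by fun_prop)
        ((rePred_avoidStep hk).comp (f := fun p : ((ℕ × ℕ) × ℕ) × ℕ => (p.1.1.1, p.2))
          (by fun_prop))))
  refine ⟨columnSetoid D, (isFC_columnSetoid (isCeer_columnSetoid hD)).2 fun e => ?_, ?_⟩
  · refine ((finite_setOf_forall_lt.2 (hfail e)).image k).subset ?_
    rintro x ⟨t, rfl, ht⟩
    exact ⟨t, ht, rfl⟩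
  · rintro ⟨f, hf, hred⟩
    obtain ⟨e, he⟩ := hf.exists_index
    classical
    let t := Nat.find (hfail e)
    have ht : ¬ AvoidStep c k e t := Nat.find_spec (hfail e)
    have hlt : ∀ j < t, AvoidStep c k e j := fun j hj => not_not.1 (Nat.find_min (hfail e) hj)
    -- Enumerating `k t` requires only the steps before `t`, so the first failure leaves exactly `k
    -- 0, ..., k t` collapsed. A correct reduction would then make step `t` succeed.
    have hDt : ∀ x, D e x ↔ ∃ i, i < t + 1 ∧ k i = x := by
      refine fun x => ⟨fun ⟨i, hi, H⟩ => ⟨i, ?_, hi⟩, fun ⟨i, hi, hx⟩ =>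
        ⟨i, hx, fun j hj => hlt j (by omega)⟩⟩
      by_contra hti
      exact ht (H t (by omega))
    have h0 : D e (k 0) := (hDt _).2 ⟨0, by omega, rfl⟩
    have key : ∀ x, (c.eval (Nat.pair (f (Nat.pair e (k 0))) (f (Nat.pair e x)))).Dom ↔
        ∃ i, i < t + 1 ∧ k i = x := fun x => by
      rw [← hc, ← hred, columnSetoid_pair, ← hDt]
      exact ⟨fun h => h.elim (fun h => h ▸ h0) And.right, fun h => .inr ⟨h0, h⟩⟩
    obtain ⟨s, hts, hs⟩ := HaltsIn.exists_uniform (c := c) (n := t + 1)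
      (x := fun j => Nat.pair (f (Nat.pair e (k 0))) (f (Nat.pair e (k j))))
      (fun j hj => (key _).2 ⟨j, hj, rfl⟩) t
    refine ht ⟨s, hts, _, (he _ _).2 rfl, fun j hj => ⟨⟨_, (he _ _).2 rfl, hs j hj⟩,
      _, (he _ _).2 rfl, ?_⟩⟩
    by_cases H : HaltsIn c (Nat.pair (f (Nat.pair e (k 0))) (f (Nat.pair e j))) s
    · exact .inr ((key j).1 (dom_iff_exists_haltsIn.2 ⟨s, H⟩))
    · exact .inl H

end avoidCC

/-! ### A CC ceer not reducible to any FC ceer. -/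

section avoidFC

/-- `ChaseStep n j`, where `n` codes a pair `(e, i)`: at some stage, the `i`-th relation
identifies the images under the `e`-th function of the elements `0, …, j` of column `n`, but
not yet the image of `j + 1`. -/
def ChaseStep (n j : ℕ) : Prop :=
  ∃ s, ∃ v, v ∈ (ofNat Code n.unpair.1).eval (Nat.pair n 0) ∧
    ∃ w, w ∈ (ofNat Code n.unpair.1).eval (Nat.pair n (j + 1)) ∧
    ¬ HaltsIn (ofNat Code n.unpair.2) (Nat.pair v w) s ∧
    ∀ m < j + 1, ∃ u, u ∈ (ofNat Code n.unpair.1).eval (Nat.pair n m) ∧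
      HaltsIn (ofNat Code n.unpair.2) (Nat.pair v u) s

theorem rePred_chaseStep : REPred fun p : ℕ × ℕ => ChaseStep p.1 p.2 := by
  unfold ChaseStep
  refine REPred.exists_nat (.exists_nat (.and (.mem_eval (by fun_prop) (by fun_prop) (by fun_prop))
    (.exists_nat (.and (.mem_eval (by fun_prop) (by fun_prop) (by fun_prop))
      (.and (computablePred_haltsIn (by fun_prop) (by fun_prop) (by fun_prop)).not.to_re
        (.forall_lt (b := fun p : (((ℕ × ℕ) × ℕ) × ℕ) × ℕ => p.1.1.1.2 + 1) (by fun_prop)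
          (.exists_nat (.and (.mem_eval (by fun_prop) (by fun_prop) (by fun_prop))
            (computablePred_haltsIn (by fun_prop) (by fun_prop) (by fun_prop)).to_re))))))))

theorem exists_isCC_not_isEssentially_isFC :
    ∃ R, IsCC R ∧ ¬ IsEssentially IsFC R := by
  let D : ℕ → ℕ → Prop := fun n k => ∀ j < k, ChaseStep n j
  have hD : REPred fun p : ℕ × ℕ => D p.1 p.2 :=
    .forall_lt (b := fun p : ℕ × ℕ => p.2) (by fun_prop)
      (rePred_chaseStep.comp (f := fun p : (ℕ × ℕ) × ℕ => (p.1.1, p.2)) (by fun_prop))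
  refine ⟨columnSetoid D, (isCC_columnSetoid (isCeer_columnSetoid hD)).2 fun n =>
    computablePred_forall_lt _, ?_⟩
  rintro ⟨S, hS, f, hf, hred⟩
  obtain ⟨e, he⟩ := hf.exists_index
  obtain ⟨c, hc⟩ := hS.1.exists_code
  obtain ⟨n, hne, hnc⟩ : ∃ n : ℕ, n.unpair.1 = e ∧ ofNat Code n.unpair.2 = c :=
    ⟨Nat.pair e (encode c), by simp, by simp⟩
  have hfail : ∃ j, ¬ ChaseStep n j := by
    by_contra! h
    have hstage : ∀ j, ∃ s, ¬ HaltsIn c (Nat.pair (f (Nat.pair n 0)) (f (Nat.pair n (j + 1)))) s ∧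
        ∀ m < j + 1, HaltsIn c (Nat.pair (f (Nat.pair n 0)) (f (Nat.pair n m))) s := fun j => by
      obtain ⟨s, v, hv, w, hw, hvw, H⟩ := h j
      rw [hne, he] at hv hw
      subst hv hw
      refine ⟨s, hnc ▸ hvw, fun m hm => ?_⟩
      obtain ⟨u, hu, H⟩ := H m hm
      rw [hne, he] at hu
      exact hu ▸ hnc ▸ H
    -- At the stage of step `j` the images of `0, ..., j` are already seen in the class and that of
    -- `j + 1` is not, so it is new.
    have hinj : Function.Injective fun m => f (Nat.pair n m) := by
      have himg : ∀ a b, a < b → f (Nat.pair n a) ≠ f (Nat.pair n b) := by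
        intro a b hab heq
        obtain ⟨j, rfl⟩ : ∃ j, b = j + 1 := ⟨b - 1, by omega⟩
        obtain ⟨s, hs, H⟩ := hstage j
        exact hs (heq ▸ H a hab)
      intro a b hab
      by_contra hab'
      rcases Nat.lt_or_gt_of_ne hab' with h | h
      · exact himg _ _ h hab
      · exact himg _ _ h hab.symm
    refine Set.infinite_range_of_injective hinj ((hS.2 (f (Nat.pair n 0))).subset ?_)
    rintro _ ⟨m, rfl⟩
    obtain ⟨s, -, H⟩ := hstage m
    exact (hc _ _).2 (dom_iff_exists_haltsIn.2 ⟨s, H m (by omega)⟩)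
  classical
  let t := Nat.find hfail
  have ht : ¬ ChaseStep n t := Nat.find_spec hfail
  have hlt : ∀ j < t, ChaseStep n j := fun j hj => not_not.1 (Nat.find_min hfail hj)
  -- With first failure `t` the column collapses `0, ..., t`. A true reduction keeps the image of `t
  -- + 1` out of the class forever, so step `t` would succeed.
  have hDt : ∀ x, D n x ↔ x < t + 1 := fun x =>
    ⟨fun H => by by_contra hx; exact ht (H t (by omega)), fun hx j hj => hlt j (by omega)⟩
  have key : ∀ x, (c.eval (Nat.pair (f (Nat.pair n 0)) (f (Nat.pair n x)))).Dom ↔ x < t + 1 :=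
    fun x => by
      rw [← hc, ← hred, columnSetoid_pair, hDt, hDt]
      omega
  obtain ⟨s, -, hs⟩ := HaltsIn.exists_uniform (c := c) (n := t + 1)
    (x := fun j => Nat.pair (f (Nat.pair n 0)) (f (Nat.pair n j))) (fun j hj => (key j).2 hj) 0
  refine ht ⟨s, f (Nat.pair n 0), hne ▸ (he _ _).2 rfl, f (Nat.pair n (t + 1)),
    hne ▸ (he _ _).2 rfl, fun h => ?_, fun m hm => ⟨f (Nat.pair n m), hne ▸ (he _ _).2 rfl, ?_⟩⟩
  · rw [hnc] at h
    exact absurd ((key _).1 (dom_iff_exists_haltsIn.2 ⟨s, h⟩)) (lt_irrefl _)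
  · rw [hnc]
    exact hs m hm

end avoidFC

end CeerTheory

namespace CeerTheory

/-! ### Upper bounds for the index sets. -/

section upper

/-- Turns generation into a search over finite paths. Entries beyond the list read as the vertex
`0`; this is harmless, since every step of the path is checked on the values read. -/
theorem eqvGen_iff_exists_path {r : ℕ → ℕ → Prop} {x y : ℕ} :
    Relation.EqvGen r x y ↔ ∃ l : List ℕ, ∃ k : ℕ, l.getD 0 0 = x ∧ l.getD k 0 = y ∧
      ∀ i < k, r (l.getD i 0) (l.getD (i + 1) 0) ∨ r (l.getD (i + 1) 0) (l.getD i 0) := by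
  constructor
  · intro h
    replace h : Relation.ReflTransGen (fun a b => r a b ∨ r b a) x y := by
      induction h with
      | rel _ _ h => exact .single (.inl h)
      | refl _ => exact .refl
      | symm _ _ _ ih =>
        have : Std.Symm fun a b => r a b ∨ r b a := ⟨fun _ _ => Or.symm⟩
        exact Std.Symm.symm _ _ ih
      | trans _ _ _ _ _ h₁ h₂ => exact h₁.trans h₂
    induction h using Relation.ReflTransGen.head_induction_on with
    | refl => exact ⟨[y], 0, rfl, rfl, by simp⟩
    | @head a c h _ ih =>
      obtain ⟨l, k, rfl, hy, H⟩ := ih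
      refine ⟨a :: l, k + 1, rfl, by simpa using hy, fun i hi => ?_⟩
      cases i with
      | zero => simpa using h
      | succ i => simpa using H i (by omega)
  · rintro ⟨l, k, rfl, rfl, H⟩
    induction k with
    | zero => exact .refl _
    | succ k ih =>
      refine .trans _ _ _ (ih fun i hi => H i (by omega)) ?_
      rcases H k (by omega) with h | h
      · exact .rel _ _ h
      · exact .symm _ _ (.rel _ _ h)

theorem rePred_mem_W {α : Type*} [Primcodable α] {f g : α → ℕ} (hf : Computable f)
    (hg : Computable g) : REPred fun a => g a ∈ W (f a) :=
  REPred.eval_dom (f := fun a => ofNat Code (f a)) (by fun_prop) hg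

theorem rePred_ceerOfIndex {α : Type*} [Primcodable α] {f g h : α → ℕ} (hf : Computable f)
    (hg : Computable g) (hh : Computable h) : REPred fun a => ceerOfIndex (f a) (g a) (h a) := by
  have H : REPred fun p : ℕ × ℕ × ℕ => ∃ l : List ℕ, ∃ k : ℕ, l.getD 0 0 = p.2.1 ∧
      l.getD k 0 = p.2.2 ∧ ∀ i < k, Nat.pair (l.getD i 0) (l.getD (i + 1) 0) ∈ W p.1 ∨
        Nat.pair (l.getD (i + 1) 0) (l.getD i 0) ∈ W p.1 := by
    refine .exists_denumerable (.exists_nat (.and (ComputablePred.natEq ?_ ?_).to_re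
      (.and (ComputablePred.natEq ?_ ?_).to_re (.forall_lt
        (b := fun p : ((ℕ × ℕ × ℕ) × List ℕ) × ℕ => p.2) ?_
        (.or (rePred_mem_W ?_ ?_) (rePred_mem_W ?_ ?_)))))) <;> fun_prop
  exact REPred.comp (p := fun p => ceerOfIndex p.1 p.2.1 p.2.2)
    (H.of_eq fun p => (eqvGen_iff_exists_path (r := fun x y => Nat.pair x y ∈ W p.1)).symm)
    (f := fun a => (f a, g a, h a)) (by fun_prop)

theorem isCeer_ceerOfIndex (e : ℕ) : IsCeer (ceerOfIndex e) :=
  rePred_ceerOfIndex (f := fun _ : ℕ × ℕ => e) (by fun_prop) (by fun_prop) (by fun_prop)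

theorem isSigma_succ_iff {n : ℕ} {A : Set ℕ} :
    IsSigma (n + 1) A ↔ ∃ B, IsSigma n B ∧ ∀ x, x ∈ A ↔ ∃ y, Nat.pair x y ∉ B :=
  ⟨fun ⟨B, hB, h⟩ => ⟨Bᶜ, hB, fun x => (h x).trans (by simp)⟩,
    fun ⟨B, hB, h⟩ => ⟨Bᶜ, by rwa [compl_compl], h⟩⟩

theorem isSigma_one_iff {A : Set ℕ} : IsSigma 1 A ↔ REPred fun x => x ∈ A := by
  rw [isSigma_succ_iff]
  constructor
  · rintro ⟨B, hB, h⟩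
    refine (REPred.exists_nat_of_computable (q := fun x y => Nat.pair x y ∉ B) ?_).of_eq
      fun x => (h x).symm
    exact (ComputablePred.comp (p := fun x => x ∈ B) hB (f := fun p : ℕ × ℕ => Nat.pair p.1 p.2)
      (by fun_prop)).not
  · intro h
    obtain ⟨q, hq, -, H⟩ := h.exists_stages
    refine ⟨{p | ¬ q p.unpair.1 p.unpair.2}, ?_, fun x => (H x).trans (by simp)⟩
    exact (ComputablePred.comp (f := Nat.unpair) hq.computablePred (by fun_prop)).not

/-- Finiteness of classes reads `∀ x, ∃ b, ∀ y`, with an r.e. condition negated under the last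
quantifier. -/
theorem isPi_isFC : IsPi 3 {e | IsFC (ceerOfIndex e)} := by
  obtain ⟨r, hr⟩ : ∃ r : ℕ → ℕ → ℕ → Prop, ∀ e x y, ceerOfIndex e x y ↔ r e x y :=
    ⟨_, fun _ _ _ => Iff.rfl⟩
  have hre : REPred fun p : ℕ × ℕ × ℕ => r p.1 p.2.1 p.2.2 :=
    (rePred_ceerOfIndex (f := fun p : ℕ × ℕ × ℕ => p.1) (g := fun p => p.2.1)
      (h := fun p => p.2.2) (by fun_prop) (by fun_prop) (by fun_prop)).of_eq fun p => hr _ _ _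
  refine isSigma_succ_iff.2 ⟨{p | ∃ b, ¬ ∃ y, r p.unpair.1 p.unpair.2 y ∧ b < y},
    isSigma_succ_iff.2 ⟨{q | ∃ y, r q.unpair.1.unpair.1 q.unpair.1.unpair.2 y ∧
      q.unpair.2 < y}, isSigma_one_iff.2 ?_, fun p => by simp⟩, fun e => ?_⟩
  · exact .exists_nat (.and (hre.comp (f := fun p : ℕ × ℕ =>
      (p.1.unpair.1.unpair.1, p.1.unpair.1.unpair.2, p.2)) (by fun_prop))
      (ComputablePred.natLt (by fun_prop) (by fun_prop)).to_re)
  · have : IsFC (ceerOfIndex e) ↔ ∀ x, ∃ b, ∀ y, r e x y → y ≤ b :=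
      ⟨fun h x => (h.2 x).bddAbove.imp fun b hb y hy => hb ((hr _ _ _).2 hy),
        fun h => ⟨isCeer_ceerOfIndex e, fun x =>
          (Set.finite_Iic _).subset fun y hy => (h x).choose_spec y ((hr _ _ _).1 hy)⟩⟩
    simp [this]

/-- Post's theorem: `c` is an r.e. index of the complement. -/
theorem computablePred_iff_exists_W {p : ℕ → Prop} (hp : REPred p) :
    ComputablePred p ↔ ∃ c, ∀ y, (p y ∨ y ∈ W c) ∧ ¬ (p y ∧ y ∈ W c) := by
  rw [ComputablePred.computable_iff_re_compl_re']
  constructor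
  · rintro ⟨-, h⟩
    obtain ⟨c, hc⟩ := h.exists_code
    refine ⟨encode c, fun y => ?_⟩
    have : y ∈ W (encode c) ↔ ¬ p y := by simp [W, hc y]
    tauto
  · rintro ⟨c, hc⟩
    refine ⟨hp, (rePred_mem_W (f := fun _ => c) (by fun_prop) .id).of_eq fun y => ?_⟩
    have := hc y
    simp only [id]
    tauto

/-- By Post's theorem the condition is `∀ x, ∃ c, ∀ y`, covering and disjointness. Disjointness is
itself universal over stages, so one `m` codes both `y` and a stage, leaving an r.e. matrix. -/
theorem isPi_isCC : IsPi 4 {e | IsCC (ceerOfIndex e)} := by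
  obtain ⟨r, hr⟩ : ∃ r : ℕ → ℕ → ℕ → Prop, ∀ e x y, ceerOfIndex e x y ↔ r e x y :=
    ⟨_, fun _ _ _ => Iff.rfl⟩
  have hre : REPred fun p : ℕ × ℕ × ℕ => r p.1 p.2.1 p.2.2 :=
    (rePred_ceerOfIndex (f := fun p : ℕ × ℕ × ℕ => p.1) (g := fun p => p.2.1)
      (h := fun p => p.2.2) (by fun_prop) (by fun_prop) (by fun_prop)).of_eq fun p => hr _ _ _
  have hboth : REPred fun t : (ℕ × ℕ) × ℕ × ℕ => r t.1.1 t.1.2 t.2.2 ∧ t.2.2 ∈ W t.2.1 :=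
    .and (hre.comp (f := fun t : (ℕ × ℕ) × ℕ × ℕ => (t.1.1, t.1.2, t.2.2)) (by fun_prop))
      (rePred_mem_W (by fun_prop) (by fun_prop))
  obtain ⟨q, hq, -, hqr⟩ := hboth.exists_stages
  refine isSigma_succ_iff.2 ⟨{p | ∃ c, ∀ m : ℕ,
    (r p.unpair.1 p.unpair.2 m.unpair.1 ∨ m.unpair.1 ∈ W c) ∧
      ¬ q (p.unpair, c, m.unpair.1) m.unpair.2},
    isSigma_succ_iff.2 ⟨{b | ∃ m : ℕ,
      ¬ ((r b.unpair.1.unpair.1 b.unpair.1.unpair.2 m.unpair.1 ∨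
        m.unpair.1 ∈ W b.unpair.2) ∧ ¬ q (b.unpair.1.unpair, b.unpair.2, m.unpair.1) m.unpair.2)},
      isSigma_succ_iff.2 ⟨{t | (r t.unpair.1.unpair.1.unpair.1
          t.unpair.1.unpair.1.unpair.2 t.unpair.2.unpair.1 ∨
        t.unpair.2.unpair.1 ∈ W t.unpair.1.unpair.2) ∧
        ¬ q (t.unpair.1.unpair.1.unpair, t.unpair.1.unpair.2, t.unpair.2.unpair.1)
          t.unpair.2.unpair.2}, isSigma_one_iff.2 ?_, fun b => ?_⟩, fun p => ?_⟩, fun e => ?_⟩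
  · refine .and (.or (hre.comp (f := fun t : ℕ =>
        (t.unpair.1.unpair.1.unpair.1, t.unpair.1.unpair.1.unpair.2, t.unpair.2.unpair.1))
        (by fun_prop))
      (rePred_mem_W (by fun_prop) (by fun_prop))) (ComputablePred.to_re (.not ?_))
    exact ComputablePred.comp (f := fun t : ℕ => ((t.unpair.1.unpair.1.unpair, t.unpair.1.unpair.2,
      t.unpair.2.unpair.1), t.unpair.2.unpair.2)) hq.computablePred (by fun_prop)
  · simp only [Set.mem_ofPred_eq, Nat.unpair_pair]
  · simp only [Set.mem_ofPred_eq, Nat.unpair_pair, not_exists, not_not]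
  · have : IsCC (ceerOfIndex e) ↔ ∀ x, ∃ c, ∀ m : ℕ,
        (r e x m.unpair.1 ∨ m.unpair.1 ∈ W c) ∧ ¬ q ((e, x), c, m.unpair.1) m.unpair.2 := by
      refine (and_iff_right (isCeer_ceerOfIndex e)).trans (forall_congr' fun x => ?_)
      simp only [hr]
      rw [computablePred_iff_exists_W
        (hre.comp (f := fun y => (e, x, y)) (by fun_prop))]
      refine exists_congr fun c => ⟨fun h m => ⟨(h _).1, fun hm =>
        (h m.unpair.1).2 ((hqr ((e, x), c, m.unpair.1)).2 ⟨_, hm⟩)⟩, fun h y => ⟨?_, fun hy => ?_⟩⟩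
      · simpa using (h (Nat.pair y 0)).1
      · obtain ⟨s, hs⟩ := (hqr ((e, x), c, y)).1 hy
        have := (h (Nat.pair y s)).2
        simp only [Nat.unpair_pair] at this
        exact this hs
    simp only [Set.mem_compl_iff, Set.mem_ofPred_eq, Nat.unpair_pair, this, not_forall]

end upper

/-! ### Hardness of the index sets. -/

section hardness

/-- The index comes from currying a single program; the pairs it enumerates already form an
equivalence relation, so generation adds nothing. -/
theorem exists_ceerOfIndex_eq_columnSetoid {D : ℕ → ℕ → ℕ → Prop}
    (hD : REPred fun p : ℕ × ℕ × ℕ => D p.1 p.2.1 p.2.2) :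
    ∃ g : ℕ → ℕ, Computable g ∧ ∀ x, ceerOfIndex (g x) = columnSetoid (D x) := by
  obtain ⟨r, hr⟩ : ∃ r : ℕ → ℕ → ℕ → Prop, ∀ x u v, columnSetoid (D x) u v ↔ r x u v :=
    ⟨_, fun _ _ _ => Iff.rfl⟩
  obtain ⟨c, hc⟩ := (((rePred_columnSetoid hD).of_eq fun p => hr _ _ _).comp
    (f := fun q : ℕ => (q.unpair.1, q.unpair.2.unpair.1, q.unpair.2.unpair.2))
    (by fun_prop)).exists_code
  refine ⟨fun x => encode (c.curry x), ?_, fun x => ?_⟩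
  · exact Computable.encode.comp (Code.primrec₂_curry.to_comp.comp (.const c) .id)
  · have h : (fun u v => Nat.pair u v ∈ W (encode (c.curry x))) = columnSetoid (D x) := by
      funext u v
      have := hc (Nat.pair x (Nat.pair u v))
      simp only [Nat.unpair_pair, encode_nat] at this
      simpa [W, Code.eval_curry, hr] using this.symm
    refine Setoid.ext fun u v => ?_
    change Relation.EqvGen _ u v ↔ _
    rw [h, (columnSetoid (D x)).iseqv.eqvGen_iff]

theorem isPiComplete_isFC : IsPiComplete 3 {e | IsFC (ceerOfIndex e)} := by
  refine ⟨isPi_isFC, fun B hB => ?_⟩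
  obtain ⟨B₁, hB₁, h₁⟩ := isSigma_succ_iff.1 hB
  obtain ⟨B₂, hB₂, h₂⟩ := isSigma_succ_iff.1 hB₁
  rw [isSigma_one_iff] at hB₂
  let D : ℕ → ℕ → ℕ → Prop := fun x n k => ∀ j < k, Nat.pair (Nat.pair x n) j ∈ B₂
  have hD : REPred fun p : ℕ × ℕ × ℕ => D p.1 p.2.1 p.2.2 :=
    .forall_lt (b := fun p : ℕ × ℕ × ℕ => p.2.2) (by fun_prop)
      (hB₂.comp (f := fun p : (ℕ × ℕ × ℕ) × ℕ => Nat.pair (Nat.pair p.1.1 p.1.2.1) p.2)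
        (by fun_prop))
  obtain ⟨g, hg, hgD⟩ := exists_ceerOfIndex_eq_columnSetoid hD
  refine ⟨g, hg, fun x => ?_⟩
  change x ∈ B ↔ IsFC (ceerOfIndex (g x))
  have hceer := isCeer_ceerOfIndex (g x)
  rw [hgD] at hceer ⊢
  rw [isFC_columnSetoid hceer, ← not_iff_not, ← Set.mem_compl_iff, h₁, not_forall]
  refine exists_congr fun n => not_congr ?_
  rw [h₂]
  exact finite_setOf_forall_lt.symm

/-- In column `m.unpair.1`, an initial segment exceeding both the first failure of `E i` and the
halting time of the program `i`, for all `i ≤ m.unpair.1`. -/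
def ThickHalting (E : ℕ → ℕ → Prop) (m : ℕ) : Prop :=
  ∃ i, i ≤ m.unpair.1 ∧ ((∀ z < m.unpair.2 + 1, E i z) ∨
    (((ofNat Code i).eval 0).Dom ∧ ¬ HaltsIn (ofNat Code i) 0 m.unpair.2))

variable {E : ℕ → ℕ → Prop}

theorem ThickHalting.anti {y k k' : ℕ} (hk : k' ≤ k) (h : ThickHalting E (Nat.pair y k)) :
    ThickHalting E (Nat.pair y k') := by
  obtain ⟨i, hi, h⟩ := h
  simp only [Nat.unpair_pair] at hi h
  refine ⟨i, by simpa using hi, ?_⟩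
  simp only [Nat.unpair_pair]
  exact h.imp (fun h z hz => h z (by omega)) fun h => ⟨h.1, fun h' => h.2 (h'.mono hk)⟩

/-- If row `i` of `E` is full, all columns from `i` on are full, and the finitely many others are
initial segments. If no row is full, every column is finite yet outlasts the halting time of its own
program, so deciding the set would solve the halting problem. -/
theorem computablePred_thickHalting_iff :
    ComputablePred (ThickHalting E) ↔ ∃ i, ∀ z, E i z := by
  constructor
  · intro h
    by_contra! hE
    choose z hz using hE
    have hout : ∀ y, ∃ k, ¬ ThickHalting E (Nat.pair y k) := by
      intro y
      have hbound : ∀ i, ∃ s, ((ofNat Code i).eval 0).Dom → HaltsIn (ofNat Code i) 0 s := fun i => by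
        by_cases hi : ((ofNat Code i).eval 0).Dom
        · obtain ⟨s, hs⟩ := dom_iff_exists_haltsIn.1 hi
          exact ⟨s, fun _ => hs⟩
        · exact ⟨0, fun h => (hi h).elim⟩
      choose s hs using hbound
      -- Beyond the first-chosen failure `z i` and the halting time `s i` of every `i ≤ y`.
      refine ⟨∑ i ∈ Finset.range (y + 1), (z i + s i), ?_⟩
      rintro ⟨i, hi, h⟩
      simp only [Nat.unpair_pair] at hi h
      have hle : z i + s i ≤ ∑ i ∈ Finset.range (y + 1), (z i + s i) :=
        Finset.single_le_sum (f := fun i => z i + s i) (fun _ _ => Nat.zero_le _)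
          (Finset.mem_range.2 (by omega))
      rcases h with h | ⟨h, h'⟩
      · exact hz i (h _ (by omega))
      · exact h' ((hs i h).mono (by omega))
    refine not_computablePred_halts (ComputablePred.computable_iff_re_compl_re'.2
      ⟨REPred.eval_dom (f := fun x => ofNat Code x) (by fun_prop) (by fun_prop), ?_⟩)
    -- Such a `k` certifies divergence: were `x` to halt after stage `k`, index `x` itself would put
    -- `k` in column `x`.
    have hre : REPred fun x : ℕ => ∃ k,
        ¬ ThickHalting E (Nat.pair x k) ∧ ¬ HaltsIn (ofNat Code x) 0 k := by
      refine .exists_nat_of_computable (.and (ComputablePred.not ?_) (ComputablePred.not ?_))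
      · exact h.comp (f := fun p : ℕ × ℕ => Nat.pair p.1 p.2) (by fun_prop)
      · exact computablePred_haltsIn (by fun_prop) (by fun_prop) (by fun_prop)
    refine hre.of_eq fun x => ⟨fun ⟨k, hk, hk'⟩ hx => hk ?_, fun hx => ?_⟩
    · exact ⟨x, by simp, .inr ⟨hx, by simpa using hk'⟩⟩
    · obtain ⟨k, hk⟩ := hout x
      exact ⟨k, hk, fun hk' => hx (dom_iff_exists_haltsIn.2 ⟨k, hk'⟩)⟩
  · rintro ⟨i, hi⟩
    have hbelow : ∀ N, ComputablePred fun m : ℕ => m.unpair.1 < N ∧ ThickHalting E m := by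
      intro N
      induction N with
      | zero => exact Set.finite_empty.computablePred.of_eq fun m => by simp
      | succ N ih =>
        have hcol : ComputablePred fun k => ∀ j < k, ThickHalting E (Nat.pair N j) :=
          computablePred_forall_lt _
        have hN : ComputablePred fun m : ℕ => m.unpair.1 = N :=
          .natEq (by fun_prop) (by fun_prop)
        -- The bound `m.unpair.2 + 1` makes the initial segment include the position of `m` itself.
        refine (ih.or (hN.and (hcol.comp (f := fun m : ℕ => m.unpair.2 + 1)
          (by fun_prop)))).of_eq fun m => ?_
        have : m.unpair.1 = N →
            ((∀ j < m.unpair.2 + 1, ThickHalting E (Nat.pair N j)) ↔ ThickHalting E m) := by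
          rintro rfl
          conv_rhs => rw [← Nat.pair_unpair m]
          exact ⟨fun h => h _ (Nat.lt_succ_self _), fun h j hj => h.anti (by omega)⟩
        rw [Nat.lt_succ_iff_lt_or_eq]
        tauto
    have hge : ComputablePred fun m : ℕ => i ≤ m.unpair.1 := .natLe (by fun_prop) (by fun_prop)
    refine (hge.or (hbelow i)).of_eq fun m => ⟨?_, fun h => ?_⟩
    · rintro (h | ⟨-, h⟩)
      · exact ⟨i, h, .inl fun z _ => hi z⟩
      · exact h
    · exact (le_or_gt i m.unpair.1).imp id fun h' => ⟨h', h⟩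

/-- Membership in `B` says that for every `n` a Σ₃ condition holds; column `n` is computable exactly
when it does. -/
theorem isPiComplete_isCC : IsPiComplete 4 {e | IsCC (ceerOfIndex e)} := by
  refine ⟨isPi_isCC, fun B hB => ?_⟩
  obtain ⟨B₁, hB₁, h₁⟩ := isSigma_succ_iff.1 hB
  obtain ⟨B₂, hB₂, h₂⟩ := isSigma_succ_iff.1 hB₁
  obtain ⟨B₃, hB₃, h₃⟩ := isSigma_succ_iff.1 hB₂
  rw [isSigma_one_iff] at hB₃
  let D : ℕ → ℕ → ℕ → Prop := fun x n =>
    ThickHalting fun i z => Nat.pair (Nat.pair (Nat.pair x n) i) z ∈ B₃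
  have hD : REPred fun p : ℕ × ℕ × ℕ => D p.1 p.2.1 p.2.2 := by
    refine .exists_nat (.and (ComputablePred.natLe (by fun_prop) (by fun_prop)).to_re (.or
      (.forall_lt (b := fun p : (ℕ × ℕ × ℕ) × ℕ => p.1.2.2.unpair.2 + 1) (by fun_prop)
        (hB₃.comp (f := fun p : ((ℕ × ℕ × ℕ) × ℕ) × ℕ =>
          Nat.pair (Nat.pair (Nat.pair p.1.1.1 p.1.1.2.1) p.1.2) p.2) (by fun_prop)))
      (.and (.eval_dom (by fun_prop) (by fun_prop))
        (computablePred_haltsIn (by fun_prop) (by fun_prop) (by fun_prop)).not.to_re)))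
  obtain ⟨g, hg, hgD⟩ := exists_ceerOfIndex_eq_columnSetoid hD
  refine ⟨g, hg, fun x => ?_⟩
  change x ∈ B ↔ IsCC (ceerOfIndex (g x))
  have hceer := isCeer_ceerOfIndex (g x)
  rw [hgD] at hceer ⊢
  rw [isCC_columnSetoid hceer, ← not_iff_not, ← Set.mem_compl_iff, h₁, not_forall]
  refine exists_congr fun n => not_congr ?_
  rw [computablePred_thickHalting_iff, h₂]
  refine exists_congr fun i => ?_
  rw [h₃, not_exists]
  simp only [not_not]

end hardness

end CeerTheory

theorem corollary5p11 :
    (¬ ∃ R : Setoid ℕ, CeerTheory.IsUniversalFor CeerTheory.IsFC R) ∧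
    (¬ ∃ R : Setoid ℕ, CeerTheory.IsUniversalFor CeerTheory.IsCC R) ∧
    (∃ R : Setoid ℕ, CeerTheory.IsCC R ∧ ¬ CeerTheory.IsEssentially CeerTheory.IsFC R) ∧
    CeerTheory.IsPiComplete 3 {e | CeerTheory.IsFC (CeerTheory.ceerOfIndex e)} ∧
    CeerTheory.IsPiComplete 4 {e | CeerTheory.IsCC (CeerTheory.ceerOfIndex e)} := by
  refine ⟨?_, ?_, CeerTheory.exists_isCC_not_isEssentially_isFC, CeerTheory.isPiComplete_isFC,
    CeerTheory.isPiComplete_isCC⟩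
  · rintro ⟨R, hR, hU⟩
    obtain ⟨S, hS, hSR⟩ := CeerTheory.exists_isFC_not_reducible hR.isCC
    exact hSR (hU S hS)
  · rintro ⟨R, hR, hU⟩
    obtain ⟨S, hS, hSR⟩ := CeerTheory.exists_isFC_not_reducible hR
    exact hSR (hU S hS.isCC)
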